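/- Notation. Let $S$ be a countably infinite set and $k \ge 1$. Write $[i]=\{1,\dots,i\}$, and $\mathrm{Inj}([i],T)$ for the set of injections $[i]\to T$ (for $i=0$ it has exactly one element, $\emptyset$). Let $K=(K_0,\dots,K_k)$ be standard Borel spaces, and let $K^{(S)}:=\prod_{i\le k}K_i^{\mathrm{Inj}([i],S)}$ with the product $\sigma$-algebra. For a permutation $g$ of $S$ put $\tau^g\big((\omega_\phi)_\phi\big):=(\omega_{g\circ\phi})_\phi$. A probability measure $\mu$ on $K^{(S)}$ is called an exchangeable random $K$-coloured directed hypergraph if $(\tau^g)_\#\mu=\mu$ for every finitely supported permutation $g$ of $S$. A sequence of ingredients consists of standard Borel spaces $Z_0,\dots,Z_{k-1}$, a probability measure $\mu_0$ on $Z_0$, Borel maps $\kappa_i:Z_i\to K_i$ for $0\le i\le k-1$ and, setting $Z_k:=K_k$, probability kernels $$P_i:\ \prod_{j=0}^{i-1}Z_j^{\mathrm{Inj}([j],[i])}\ \rightsquigarrow\ Z_i^{\mathrm{Sym}([i])}\qquad(1\le i\le k)$$ that are covariant under $\mathrm{Sym}([i])$: for all $g\in\mathrm{Sym}([i])$ and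 all points $x=(x_\psi)_\psi$ of the domain, $P_i\big((x_{g\circ\psi})_\psi,\cdot\big)$ is the image of $P_i(x,\cdot)$ under $(y_\sigma)_\sigma\mapsto(y_{g\circ\sigma})_\sigma$. The standard recipe produces a random $\omega\in K^{(S)}$ as follows. Choose $z_\emptyset\in Z_0$ according to $\mu_0$. Then, successively for $i=1,\dots,k$, given all $z_\psi$ with $\psi\in\mathrm{Inj}([j],S)$, $j<i$, choose for the sets $u\in\binom{S}{i}$, independently of one another, the clusters $(z_\phi)_{\phi\in\mathrm{Inj}([i],u)}\in Z_i^{\mathrm{Inj}([i],u)}$ according to $P_i\big((z_\psi)_{\psi\in\mathrm{Inj}([j],u),\,j<i},\cdot\big)$. Here $u$ is identified with $[i]$ through any bijection $e:[i]\to u$; by covariance the choice of $e$ does not matter. Finally set $\omega_\phi:=\kappa_i(z_\phi)$ for $\phi\in\mathrm{Inj}([i],S)$, $i<k$, and $\omega_\phi:=z_\phi$ for $\phi\in\mathrm{Inj}([k],S)$. The ingredients yield $\mu$ if $\mu$ is the law of $\omega$. Theorem 3.21 (Structure theorem for exchangeable random directed hypergraph colourings). For every exchangeable random $K$-coloured directed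 hypergraph $\mu$ on $S$ there is a sequence of ingredients that yields $\mu$ upon following the standard recipe. -/

import Mathlib

open MeasureTheory ProbabilityTheory

universe u v w

/-- The space `∏_{i < n} W_i ^ Inj([i], S)` of all `W`-coloured directed hypergraphs on `S`, with its
product σ-algebra. Here `[i]` is `Fin i` and `Inj([i], S)` is `Fin i ↪ S`; the palette `W` has the
colour spaces `W_0, …, W_{n-1}`, so that palettes of rank `k` are the case `n = k + 1`. -/
abbrev DirColouring {n : ℕ} (W : Fin n → Type u) (S : Type v) : Type (max u v) :=
  ∀ i : Fin n, (Fin (i : ℕ) ↪ S) → W i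

namespace DirColouring

/-- The colouring of `T` induced along an injection `f : T ↪ S`: the tuple `φ` gets the colour of
`f ∘ φ`. For a permutation `f = g` of `S` this is the coordinate-permuting map `τ^g`. -/
def comap {n : ℕ} {W : Fin n → Type u} {S : Type v} {T : Type w} (f : T ↪ S)
    (x : DirColouring W S) : DirColouring W T :=
  fun i φ => x i (φ.trans f)

/-- Adjoin colours for the injective `n`-tuples to a colouring of the shorter tuples. -/
def extend {n : ℕ} {W : Fin (n + 1) → Type u} {S : Type v}
    (x : DirColouring (fun i : Fin n => W i.castSucc) S) (y : (Fin n ↪ S) → W (Fin.last n)) :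
    DirColouring W S :=
  Fin.snoc (α := fun i : Fin (n + 1) => (Fin (i : ℕ) ↪ S) → W i) x y

theorem measurable_comap {n : ℕ} {W : Fin n → Type u} [∀ i, MeasurableSpace (W i)]
    {S : Type v} {T : Type w} (f : T ↪ S) :
    Measurable (comap f : DirColouring W S → DirColouring W T) := by
  unfold comap
  fun_prop

theorem measurable_extend {n : ℕ} {W : Fin (n + 1) → Type u} [∀ i, MeasurableSpace (W i)]
    {S : Type v} :
    Measurable (fun p : DirColouring (fun i : Fin n => W i.castSucc) S ×
      ((Fin n ↪ S) → W (Fin.last n)) => extend p.1 p.2) := by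
  refine measurable_pi_iff.2 fun i => ?_
  induction i using Fin.lastCases with
  | last => simpa [extend] using measurable_snd
  | cast i =>
    simp only [extend, Fin.snoc_castSucc]
    exact (measurable_pi_apply i).comp measurable_fst

end DirColouring

/-- A random `K`-coloured directed hypergraph is exchangeable if its law is invariant under `τ^g`
for every finitely supported permutation `g` of the vertex set. -/
def IsExchangeable {n : ℕ} {K : Fin n → Type u} [∀ i, MeasurableSpace (K i)] {S : Type v}
    (μ : Measure (DirColouring K S)) : Prop :=
  ∀ g : Equiv.Perm S, {s | g s ≠ s}.Finite → μ.map (DirColouring.comap g.toEmbedding) = μ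

/-- The first `n` colour spaces of a palette. -/
abbrev truncate {N : ℕ} (Z : Fin N → Type u) (n : ℕ) (h : n ≤ N) : Fin n → Type u :=
  fun j => Z (j.castLE h)

section Cluster

variable {n : ℕ} {W : Fin n → Type u} [∀ i, MeasurableSpace (W i)] {L : Type u}
  [MeasurableSpace L] {S : Type v}

/-- Covariance of a kernel `∏_{j < n} W_j ^ Inj([j], [n]) ⇝ L ^ Sym([n])` under the
coordinate-permuting actions of `Sym([n])` on its domain and on its target. -/
def IsCovariant (P : Kernel (DirColouring W (Fin n)) (Equiv.Perm (Fin n) → L)) : Prop :=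
  ∀ (g : Equiv.Perm (Fin n)) (x : DirColouring W (Fin n)),
    P (x.comap g.toEmbedding) = (P x).map (fun y σ => y (g * σ))

/-- Given an enumeration `e` of the `n`-set `u`, the permutation `σ` of `[n]` with `e ∘ σ = φ`. -/
noncomputable def permOfEnum {u : Finset S} (e : Fin n ≃ u) (φ : Fin n ↪ u) :
    Equiv.Perm (Fin n) :=
  Equiv.ofBijective (fun i => e.symm (φ i))
    (Finite.injective_iff_bijective.1 (e.symm.injective.comp φ.injective))

/-- The law of the cluster `(z_φ)`, `φ ∈ Inj([n], u)`, given the colouring `x` of the shorter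
tuples: identify `u` with `[n]` through the enumeration `e`, and apply `P` to the colours under `x`
of the tuples in `u`. -/
noncomputable def clusterLaw (P : Kernel (DirColouring W (Fin n)) (Equiv.Perm (Fin n) → L))
    (x : DirColouring W S) {u : Finset S} (e : Fin n ≃ u) : Measure ((Fin n ↪ u) → L) :=
  (P (x.comap (e.toEmbedding.trans (Function.Embedding.subtype _)))).map
    (fun y φ => y (permOfEnum e φ))

theorem measurable_relabel {u : Finset S} (e : Fin n ≃ u) :
    Measurable (fun (y : Equiv.Perm (Fin n) → L) (φ : Fin n ↪ u) => y (permOfEnum e φ)) := by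
  fun_prop

instance (P : Kernel (DirColouring W (Fin n)) (Equiv.Perm (Fin n) → L)) [IsMarkovKernel P]
    (x : DirColouring W S) {u : Finset S} (e : Fin n ≃ u) :
    IsProbabilityMeasure (clusterLaw P x e) :=
  Measure.isProbabilityMeasure_map (measurable_relabel e).aemeasurable

/-- For a covariant kernel the law of the cluster above `u` does not depend on the enumeration. -/
theorem clusterLaw_eq (P : Kernel (DirColouring W (Fin n)) (Equiv.Perm (Fin n) → L))
    (hP : IsCovariant P) (x : DirColouring W S) {u : Finset S} (e e' : Fin n ≃ u) :
    clusterLaw P x e = clusterLaw P x e' := by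
  have h := hP (e'.trans e.symm) (x.comap (e.toEmbedding.trans (Function.Embedding.subtype _)))
  have h2 : (x.comap (e.toEmbedding.trans (Function.Embedding.subtype _))).comap
      (e'.trans e.symm).toEmbedding =
      x.comap (e'.toEmbedding.trans (Function.Embedding.subtype _)) := by
    funext i φ
    simp only [DirColouring.comap]
    congr 1
    ext j
    simp
  unfold clusterLaw
  rw [← h2, h, Measure.map_map (measurable_relabel e') (by fun_prop)]
  congr 1
  funext y φ
  simp only [Function.comp]
  congr 1
  ext j
  simp [permOfEnum]

theorem measurable_clusterLaw (P : Kernel (DirColouring W (Fin n)) (Equiv.Perm (Fin n) → L))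
    {u : Finset S} (e : Fin n ≃ u) : Measurable (fun x : DirColouring W S => clusterLaw P x e) :=
  (Measure.measurable_map _ (measurable_relabel e)).comp
    (P.measurable.comp (DirColouring.measurable_comap _))

/-- Colours for all `n`-tuples, assembled from one cluster of colours above each `n`-set. -/
def assemble (y : ∀ u : {u : Finset S // u.card = n}, (Fin n ↪ u.1) → L) : (Fin n ↪ S) → L :=
  fun φ => y ⟨Finset.univ.map φ, by simp⟩
    ⟨fun i => ⟨φ i, by simp⟩, fun i j hij => φ.injective (congrArg Subtype.val hij)⟩

theorem measurable_assemble : Measurable (assemble (n := n) (L := L) (S := S)) := by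
  unfold assemble
  fun_prop

/-- One step of the recipe. Given the colouring `x` of all shorter tuples, the clusters
`(z_φ)`, `φ ∈ Inj([n], u)`, for distinct `n`-sets `u` are chosen independently, each according to
`P` evaluated at the colours of the tuples in `u`. -/
noncomputable def clusterKernel (P : Kernel (DirColouring W (Fin n)) (Equiv.Perm (Fin n) → L))
    [IsMarkovKernel P] (S : Type v) : Kernel (DirColouring W S) ((Fin n ↪ S) → L) where
  toFun x := (Measure.infinitePi fun u : {u : Finset S // u.card = n} =>
    clusterLaw P x (u.1.equivFinOfCardEq u.2).symm).map assemble
  measurable' := by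
    refine (Measure.measurable_map _ measurable_assemble).comp ?_
    refine Measurable.measure_of_isPiSystem_of_isProbabilityMeasure
      (generateFrom_squareCylinders).symm
      (isPiSystem_squareCylinders (fun _ => MeasurableSpace.isPiSystem_measurableSet)
        (fun _ => by simp)) ?_
    rintro _ ⟨s, t, ht, rfl⟩
    simp only [Set.mem_pi, Set.mem_univ, true_imp_iff, Set.mem_ofPred_eq] at ht
    have : ∀ x : DirColouring W S,
        (Measure.infinitePi fun u : {u : Finset S // u.card = n} =>
          clusterLaw P x (u.1.equivFinOfCardEq u.2).symm) ((s : Set _).pi t) =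
        ∏ u ∈ s, clusterLaw P x (u.1.equivFinOfCardEq u.2).symm (t u) :=
      fun x => Measure.infinitePi_pi _ (fun u _ => ht u)
    simp only [this]
    exact Finset.measurable_prod _ fun u _ =>
      (Measure.measurable_coe (ht u)).comp (measurable_clusterLaw P _)

instance (P : Kernel (DirColouring W (Fin n)) (Equiv.Perm (Fin n) → L)) [IsMarkovKernel P]
    (S : Type v) : IsMarkovKernel (clusterKernel P S) :=
  ⟨fun _ => Measure.isProbabilityMeasure_map measurable_assemble.aemeasurable⟩

end Cluster

/-- A sequence of ingredients `(Z_0, κ_0, μ_0), (Z_1, κ_1, P_1), …, (Z_k, κ_k, P_k), (K_{k+1}, P_{k+1})`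
for a palette `K_0, …, K_{k+1}` of rank `k + 1 ≥ 1`. -/
structure DirectedIngredients {k : ℕ} (K : Fin (k + 2) → Type u) [∀ i, MeasurableSpace (K i)] where
  /-- The spaces `Z_0, …, Z_k`. -/
  Z : Fin (k + 1) → Type u
  [measurableSpace : ∀ i, MeasurableSpace (Z i)]
  [standardBorel : ∀ i, StandardBorelSpace (Z i)]
  /-- The maps `κ_i : Z_i → K_i` for `i ≤ k`. -/
  κ : ∀ i : Fin (k + 1), Z i → K i.castSucc
  measurable_κ : ∀ i, Measurable (κ i)
  /-- The law `μ_0` on `Z_0`. -/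
  μ₀ : Measure (Z 0)
  [isProbabilityMeasure : IsProbabilityMeasure μ₀]
  /-- The kernels `P_1, …, P_k`; `P i` is the kernel `P_{i+1}`, with values in
  `Z_{i+1} ^ Sym([i+1])`. -/
  P : ∀ i : Fin k, Kernel (DirColouring (truncate Z (i.succ : ℕ) i.succ.is_lt.le) (Fin (i.succ : ℕ)))
    (Equiv.Perm (Fin (i.succ : ℕ)) → Z i.succ)
  [isMarkovKernel : ∀ i, IsMarkovKernel (P i)]
  covariant : ∀ i, IsCovariant (P i)
  /-- The last kernel `P_{k+1}`, with values in `K_{k+1} ^ Sym([k+1])`. -/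
  Ptop : Kernel (DirColouring Z (Fin (k + 1))) (Equiv.Perm (Fin (k + 1)) → K (Fin.last (k + 1)))
  [isMarkovKernel_top : IsMarkovKernel Ptop]
  covariant_top : IsCovariant Ptop

namespace DirectedIngredients

attribute [instance] measurableSpace standardBorel isProbabilityMeasure isMarkovKernel
  isMarkovKernel_top

variable {k : ℕ} {K : Fin (k + 2) → Type u} [∀ i, MeasurableSpace (K i)]
  (I : DirectedIngredients K)

/-- The kernels used at ranks `0, …, k`: at rank `0` the law `μ_0` (the source and `Sym([0])` have
one point each), at rank `i + 1` the kernel `P i`. -/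
noncomputable def rankKernel : (i : ℕ) → (h : i < k + 1) →
    Kernel (DirColouring (truncate I.Z i h.le) (Fin i)) (Equiv.Perm (Fin i) → I.Z ⟨i, h⟩)
  | 0, _ => Kernel.const _ (I.μ₀.map fun z _ => z)
  | i + 1, h => I.P ⟨i, Nat.lt_of_succ_lt_succ h⟩

instance (i : ℕ) (h : i < k + 1) : IsMarkovKernel (I.rankKernel i h) := by
  cases i with
  | zero =>
    refine ⟨fun _ => ?_⟩
    have h : IsProbabilityMeasure I.μ₀ := I.isProbabilityMeasure
    exact @Measure.isProbabilityMeasure_map _ _ _ _ I.μ₀ h _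
      (measurable_pi_lambda _ fun _ => measurable_id).aemeasurable
  | succ i => exact I.isMarkovKernel _

/-- The joint law of all the `z_φ`, `φ ∈ Inj([i], S)`, chosen at the ranks `i < n`. -/
noncomputable def stageLaw (S : Type v) :
    (n : ℕ) → (h : n ≤ k + 1) → Measure (DirColouring (truncate I.Z n h) S)
  | 0, _ => Measure.dirac fun i => i.elim0
  | n + 1, h => (stageLaw S n (Nat.le_of_succ_le h) ⊗ₘ
      clusterKernel (I.rankKernel n h) S).map
        fun p => DirColouring.extend (W := truncate I.Z (n + 1) h) p.1 p.2

instance (S : Type v) (n : ℕ) (h : n ≤ k + 1) : IsProbabilityMeasure (I.stageLaw S n h) := by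
  induction n with
  | zero => exact Measure.dirac.isProbabilityMeasure
  | succ n ih =>
    have := ih (Nat.le_of_succ_le h)
    exact Measure.isProbabilityMeasure_map
      (DirColouring.measurable_extend (W := truncate I.Z (n + 1) h)).aemeasurable

/-- The law of the random `K`-coloured directed hypergraph on `S` that the standard recipe produces:
choose all `z_φ` of ranks `≤ k`, choose the colours `ω_φ` of the `(k+1)`-tuples according to the last
kernel, and set `ω_φ = κ_i (z_φ)` at the ranks `i ≤ k`. -/
noncomputable def recipeLaw (S : Type v) : Measure (DirColouring K S) :=
  (I.stageLaw S (k + 1) le_rfl ⊗ₘ clusterKernel I.Ptop S).map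
    fun p => DirColouring.extend (fun i φ => I.κ i (p.1 i φ)) p.2

/-- The ingredients yield `μ` upon following the standard recipe. -/
def Yields {S : Type v} (μ : Measure (DirColouring K S)) : Prop :=
  I.recipeLaw S = μ

instance (S : Type v) : IsProbabilityMeasure (I.recipeLaw S) := by
  refine Measure.isProbabilityMeasure_map (Measurable.aemeasurable ?_)
  have h : Measurable fun p : DirColouring I.Z S × ((Fin (k + 1) ↪ S) → K (Fin.last (k + 1))) =>
      ((fun i φ => I.κ i (p.1 i φ) : DirColouring (fun i => K i.castSucc) S), p.2) := by
    have := I.measurable_κ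
    fun_prop
  exact DirColouring.measurable_extend.comp h

end DirectedIngredients

/-! The vertex set is enlarged by a countable tail: since `S ⊕ ℕ` is in bijection with `S`, the law
`μ` is the restriction to `S` of an exchangeable law `ν` on `S ⊕ ℕ`. The ingredient `z_φ` is the
whole restriction of the colouring to the vertices of `φ` together with the tail. It determines
`ω_φ` and all ingredients of subtuples of `φ`.

The recipe reproduces `ν` once it is known that, given the tail colours of rank below `n`, the
clusters above distinct `n`-sets are independent, each with a law that depends only on the tail
colours inside its own set, through one covariant kernel.

The core is `setLIntegral_eq_of_avoidingSigma`: given the tail colours of the proper subtuples of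
`e`, the tail colour of `e` is independent of the tail colours of all tuples missing a vertex of
`e`. An injection of `S ⊕ ℕ` into itself that fixes `e` and pushes every other vertex into the tail
preserves `ν`, turns information of the second kind into information about proper subtuples of `e`,
and can be made to fix any given event on finitely many vertices of `e` and the tail. An `L²`
argument (`setLIntegral_eq_of_comap_le`) then shows that the larger σ-algebra predicts this event no
better than the smaller one. Covariance at every point comes from averaging over the finite group
`Sym([n])` (`exists_covariant_kernel`), and independence of the clusters from conditioning on one at
a time (`lintegral_mul_prod_indicator`). -/

/-! ### Exchangeability as equality of marginals along embeddings -/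

theorem Function.Embedding.exists_perm_finite_support {S : Type*} {T : Type*} [Finite T]
    (f f' : T ↪ S) :
    ∃ g : Equiv.Perm S, {s | g s ≠ s}.Finite ∧ f.trans g.toEmbedding = f' := by
  classical
  let U : Set S := Set.range f ∪ Set.range f'
  have hU : U.Finite := (Set.finite_range f).union (Set.finite_range f')
  have : Finite U := hU
  let a : T ↪ U := f.codRestrict U fun t => Or.inl ⟨t, rfl⟩
  let b : T ↪ U := f'.codRestrict U fun t => Or.inr ⟨t, rfl⟩
  obtain ⟨σ, hσ⟩ := Equiv.Perm.exists_extending_pair a b a.injective b.injective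
  refine ⟨Equiv.Perm.ofSubtype σ, hU.subset fun s hs => ?_, ?_⟩
  · by_contra h
    exact hs (Equiv.Perm.ofSubtype_apply_of_not_mem σ h)
  · ext t
    have h : Equiv.Perm.ofSubtype σ ((a t : U) : S) = (σ (a t) : U) :=
      Equiv.Perm.ofSubtype_apply_coe σ (a t)
    have h2 : σ (a t) = b t := hσ t
    rw [h2] at h
    exact h

namespace DirColouring

variable {n : ℕ} {K : Fin n → Type u} [∀ i, MeasurableSpace (K i)] {S : Type v} {T : Type w}

/-- A finite measure on colourings is determined by its marginals on finite vertex sets. -/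
theorem measure_ext {m₁ m₂ : Measure (DirColouring K T)} [IsFiniteMeasure m₁]
    (h : ∀ s : Finset T, m₁.map (comap (Function.Embedding.subtype (· ∈ s))) =
      m₂.map (comap (Function.Embedding.subtype (· ∈ s)))) : m₁ = m₂ := by
  classical
  let σ : Finset T → MeasurableSpace (DirColouring K T) := fun s =>
    MeasurableSpace.comap (comap (Function.Embedding.subtype (· ∈ s))) MeasurableSpace.pi
  have hσ : Monotone σ := by
    intro s s' hs
    let r : s ↪ s' := ⟨fun a => ⟨a, hs a.2⟩, fun a b hab => Subtype.ext (congrArg (·.1) hab)⟩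
    have hr : (comap (Function.Embedding.subtype (· ∈ s)) : DirColouring K T → _) =
        comap r ∘ comap (Function.Embedding.subtype (· ∈ s')) := rfl
    change MeasurableSpace.comap _ _ ≤ MeasurableSpace.comap _ _
    rw [hr, ← MeasurableSpace.comap_comp]
    exact MeasurableSpace.comap_mono (measurable_comap r).comap_le
  refine ext_of_generate_finite (⋃ s, {t | MeasurableSet[σ s] t}) ?_
    (isPiSystem_iUnion_of_monotone _ (fun s => (σ s).isPiSystem_measurableSet)
      fun _ _ hs _ ht => hσ hs _ ht) ?_ ?_
  · refine Eq.trans ?_ (MeasurableSpace.generateFrom_iUnion_measurableSet σ).symm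
    refine le_antisymm ?_ (iSup_le fun s => (measurable_comap _).comap_le)
    simp only [MeasurableSpace.pi, MeasurableSpace.comap_iSup, MeasurableSpace.comap_comp]
    refine iSup_le fun i => iSup_le fun φ => ?_
    have h1 : Measurable[σ (Finset.univ.map φ)] fun x : DirColouring K T => x i φ := by
        have : (fun x : DirColouring K T => x i φ) =
            (fun y : DirColouring K (Finset.univ.map φ : Finset T) =>
              y i ⟨fun a => ⟨φ a, by simp⟩,
                fun a b hab => φ.injective (congrArg Subtype.val hab)⟩) ∘
            comap (Function.Embedding.subtype (· ∈ Finset.univ.map φ)) := rfl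
        rw [this]
        exact Measurable.comp (by fun_prop) (comap_measurable _)
    exact h1.comap_le.trans (le_iSup σ _)
  · rintro t ht
    obtain ⟨s, t', ht', rfl⟩ := Set.mem_iUnion.1 ht
    rw [← Measure.map_apply (measurable_comap _) ht', h,
      Measure.map_apply (measurable_comap _) ht']
  · have h0 := congrArg (fun m => m Set.univ) (h ∅)
    simpa [Measure.map_apply (measurable_comap _) MeasurableSet.univ] using h0

theorem map_comap_map_comap {R : Type*} (m : Measure (DirColouring K S)) (f : T ↪ S) (g : R ↪ T) :
    (m.map (comap f)).map (comap g) = m.map (comap (g.trans f)) := by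
  rw [Measure.map_map (measurable_comap _) (measurable_comap _)]
  rfl

end DirColouring

/-- The marginals of an exchangeable law along two embeddings of the same vertex set agree. -/
theorem IsExchangeable.map_comap_eq {n : ℕ} {K : Fin n → Type u} [∀ i, MeasurableSpace (K i)]
    {S : Type v} {T : Type w} {μ : Measure (DirColouring K S)} [IsFiniteMeasure μ]
    (hμ : IsExchangeable μ) (f f' : T ↪ S) :
    μ.map (DirColouring.comap f) = μ.map (DirColouring.comap f') := by
  refine DirColouring.measure_ext fun s => ?_
  obtain ⟨g, hg, hgf⟩ := Function.Embedding.exists_perm_finite_support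
    ((Function.Embedding.subtype (· ∈ s)).trans f') ((Function.Embedding.subtype (· ∈ s)).trans f)
  rw [DirColouring.map_comap_map_comap, DirColouring.map_comap_map_comap, ← hgf,
    ← DirColouring.map_comap_map_comap, hμ g hg]

theorem IsExchangeable.map_comap {n : ℕ} {K : Fin n → Type u} [∀ i, MeasurableSpace (K i)]
    {S : Type v} {T : Type w} {μ : Measure (DirColouring K S)} [IsFiniteMeasure μ]
    (hμ : IsExchangeable μ) (f : T ↪ S) : IsExchangeable (μ.map (DirColouring.comap f)) := by
  intro g _
  rw [DirColouring.map_comap_map_comap]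
  exact hμ.map_comap_eq _ _

/-! ### Conditional probabilities of invariant events -/

/-- Conditional probabilities of a `τ`-invariant event given a σ-algebra `F` are conditional
probabilities given any larger σ-algebra `G` that `τ` pulls back into `F`. -/
theorem MeasureTheory.MeasurePreserving.setLIntegral_eq_of_comap_le {Ω : Type*}
    {F G mΩ : MeasurableSpace Ω} {ν : Measure Ω} [IsProbabilityMeasure ν] {τ : Ω → Ω}
    (hτ : MeasurePreserving τ ν ν) (hGF : G.comap τ ≤ F) (hFG : F ≤ G)
    (hG : G ≤ mΩ) {E : Set Ω} (hE : MeasurableSet E) (hinv : τ ⁻¹' E = E) {c : Ω → ENNReal}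
    (hc : Measurable[F] c)
    (hcE : ∀ B, MeasurableSet[F] B → ∫⁻ ω in B, c ω ∂ν = ν (E ∩ B)) {B : Set Ω}
    (hB : MeasurableSet[G] B) : ∫⁻ ω in B, c ω ∂ν = ν (E ∩ B) := by
  have hF : F ≤ mΩ := hFG.trans hG
  set f : Ω → ℝ := E.indicator 1 with hf
  have hfi : Integrable f ν := (integrable_const (1 : ℝ)).indicator hE
  have hfτ : ∀ ω, f (τ ω) = f ω := fun ω => by
    have : τ ω ∈ E ↔ ω ∈ E := by rw [← Set.mem_preimage, hinv]
    by_cases h : ω ∈ E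
    · rw [hf, Set.indicator_of_mem h, Set.indicator_of_mem (this.2 h)]; rfl
    · rw [hf, Set.indicator_of_notMem h, Set.indicator_of_notMem (mt this.1 h)]
  set d : Ω → ℝ := ν[f | G] with hd
  have hdm : StronglyMeasurable[G] d := stronglyMeasurable_condExp
  have hdi : Integrable d ν := integrable_condExp
  have hτG : Measurable[F, G] τ := measurable_iff_comap_le.2 hGF
  -- The aim is `d = d ∘ τ` almost everywhere, as `d ∘ τ` depends on `F` alone.
  have hdτF : StronglyMeasurable[F] (d ∘ τ) := (hdm.measurable.comp hτG).stronglyMeasurable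
  have hd0 : ∀ᵐ ω ∂ν, ‖d ω‖ ≤ 1 := by
    have := ae_bdd_abs_condExp_of_ae_bdd_abs (R := 1) (m := G) (μ := ν) (f := f)
      (Filter.Eventually.of_forall fun ω => by
        by_cases h : ω ∈ E <;> simp [hf, h])
    simpa using this
  have hdτ0 : ∀ᵐ ω ∂ν, ‖d (τ ω)‖ ≤ 1 := hτ.quasiMeasurePreserving.ae hd0
  have hdaes : AEStronglyMeasurable d ν := hdi.aestronglyMeasurable
  have hdτaes : AEStronglyMeasurable (d ∘ τ) ν := (hdτF.mono hF).aestronglyMeasurable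
  have hdτi : Integrable (d ∘ τ) ν := hτ.integrable_comp_of_integrable hdi
  -- pairing a bounded `G`-measurable function with `d` is the same as pairing it with `f`
  have hpair : ∀ b : Ω → ℝ, StronglyMeasurable[G] b → (∀ᵐ ω ∂ν, ‖b ω‖ ≤ 1) →
      ∫ ω, b ω * d ω ∂ν = ∫ ω, b ω * f ω ∂ν := by
    intro b hb hb1
    have hbf : Integrable (b * f) ν := hfi.bdd_mul (hb.mono hG).aestronglyMeasurable hb1
    have h1 := condExp_mul_of_stronglyMeasurable_left hb hbf hfi
    calc ∫ ω, b ω * d ω ∂ν = ∫ ω, (ν[b * f | G]) ω ∂ν :=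
          (integral_congr_ae h1).symm
      _ = ∫ ω, b ω * f ω ∂ν := integral_condExp hG
  have h1 : ∫ ω, d ω * d ω ∂ν = ∫ ω, d ω * f ω ∂ν := hpair d hdm hd0
  have h2 : ∫ ω, d (τ ω) * d ω ∂ν = ∫ ω, d (τ ω) * f ω ∂ν :=
    hpair (d ∘ τ) (hdτF.mono hFG) hdτ0
  have hcomp : ∀ b : Ω → ℝ, AEStronglyMeasurable b ν → ∫ ω, b (τ ω) ∂ν = ∫ ω, b ω ∂ν := by
    intro b hb
    rw [← integral_map hτ.measurable.aemeasurable (by rwa [hτ.map_eq]), hτ.map_eq]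
  have h3 : ∫ ω, d (τ ω) * f ω ∂ν = ∫ ω, d ω * f ω ∂ν := by
    rw [← hcomp (fun ω => d ω * f ω) (hdaes.mul hfi.aestronglyMeasurable)]
    simp only [hfτ]
  have h4 : ∫ ω, d (τ ω) * d (τ ω) ∂ν = ∫ ω, d ω * d ω ∂ν :=
    hcomp (fun ω => d ω * d ω) (hdaes.mul hdaes)
  have hi1 : Integrable (fun ω => d ω * d ω) ν := hdi.bdd_mul hdaes hd0
  have hi2 : Integrable (fun ω => d (τ ω) * d ω) ν := hdi.bdd_mul hdτaes hdτ0
  have hi3 : Integrable (fun ω => d (τ ω) * d (τ ω)) ν := hdτi.bdd_mul hdτaes hdτ0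
  -- Invariance of `ν` gives `d` and `d ∘ τ` the same norm. Their inner product is that of `d ∘ τ`
  -- with `f`, which by `f ∘ τ = f` is that of `d` with `f`, hence again the squared norm of `d`.
  have h5 : ∫ ω, (d ω - d (τ ω)) ^ 2 ∂ν = 0 := by
    have : ∀ ω, (d ω - d (τ ω)) ^ 2 =
        d ω * d ω - 2 * (d (τ ω) * d ω) + d (τ ω) * d (τ ω) := fun ω => by ring
    simp only [this]
    rw [integral_add (f := fun ω => d ω * d ω - 2 * (d (τ ω) * d ω)) (hi1.sub (hi2.const_mul 2)) hi3, integral_sub hi1 (hi2.const_mul 2),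
      integral_const_mul, h4, h2, h3, h1]
    ring
  have h6 : d =ᵐ[ν] d ∘ τ := by
    have hi : Integrable (fun ω => (d ω - d (τ ω)) ^ 2) ν := by
      have : ∀ ω, (d ω - d (τ ω)) ^ 2 =
        d ω * d ω - 2 * (d (τ ω) * d ω) + d (τ ω) * d (τ ω) := fun ω => by ring
      simp only [this]
      exact (hi1.sub (hi2.const_mul 2)).add hi3
    have := (integral_eq_zero_iff_of_nonneg (fun ω => sq_nonneg _) hi).1 h5
    filter_upwards [this] with ω hω
    simpa [sub_eq_zero] using hω
  -- so `d` is a version of the conditional probability given `F`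
  have hcm : Measurable c := hc.mono hF le_rfl
  have hcfin : ∀ B, ∫⁻ ω in B, c ω ∂ν ≠ ⊤ := fun B => by
    refine ne_top_of_le_ne_top ?_ (setLIntegral_le_lintegral B c)
    rw [← setLIntegral_univ, hcE _ MeasurableSet.univ]
    exact measure_ne_top _ _
  have hclt : ∀ᵐ ω ∂ν, c ω < ⊤ := ae_lt_top hcm (by simpa using hcfin Set.univ)
  have hci : Integrable (fun ω => (c ω).toReal) ν :=
    integrable_toReal_of_lintegral_ne_top hcm.aemeasurable (by simpa using hcfin Set.univ)
  have hcint : ∀ B, ∫ ω in B, (c ω).toReal ∂ν = (∫⁻ ω in B, c ω ∂ν).toReal := fun B =>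
    integral_toReal hcm.aemeasurable (ae_restrict_of_ae hclt)
  have hfint : ∀ B, MeasurableSet B → ∫ ω in B, f ω ∂ν = (ν (E ∩ B)).toReal := fun B hB => by
    rw [hf, integral_indicator_one hE, measureReal_def, Measure.restrict_apply hE]
  have h7 : (fun ω => (c ω).toReal) =ᵐ[ν] d ∘ τ := by
    refine ae_eq_of_forall_setIntegral_eq_of_sigmaFinite' hF (fun s _ _ => hci.integrableOn)
      (fun s _ _ => hdτi.integrableOn) (fun s hs _ => ?_)
      (hc.ennreal_toReal.stronglyMeasurable.aestronglyMeasurable) hdτF.aestronglyMeasurable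
    rw [hcint, hcE s hs, ← hfint s (hF _ hs), ← setIntegral_condExp hG hfi (hFG _ hs)]
    exact setIntegral_congr_ae (hF _ hs) (h6.mono fun ω hω _ => hω)
  rw [← ENNReal.toReal_eq_toReal_iff' (hcfin B) (measure_ne_top _ _), ← hcint,
    ← hfint B (hG _ hB), ← setIntegral_condExp hG hfi hB]
  exact setIntegral_congr_ae (hG _ hB) ((h7.trans h6.symm).mono fun ω hω _ => hω)

/-! ### Tail colourings and covariant conditional laws -/

instance Function.Embedding.countable_of_finite {A T : Type*} [Finite A] [Countable T] :
    Countable (A ↪ T) :=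
  Function.Injective.countable (f := fun f : A ↪ T => (f : A → T)) DFunLike.coe_injective

namespace DirColouring

/-- An injection extended by the identity of a fixed countable set of auxiliary vertices. -/
abbrev withTail {R : Type*} {T : Type*} (ψ : R ↪ T) : R ⊕ ℕ ↪ T ⊕ ℕ :=
  ψ.sumMap (Function.Embedding.refl ℕ)

variable {m : ℕ} {K : Fin m → Type u}

/-- The palette whose colours of rank `j` are `K`-colourings of `j` vertices together with the
auxiliary vertices. -/
abbrev tailPalette (K : Fin m → Type u) (n : ℕ) : Fin n → Type u :=
  fun j => DirColouring K (Fin (j : ℕ) ⊕ ℕ)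

/-- The colouring that gives the tuple `ψ` the restriction of `ω` to the vertices of `ψ` together
with the auxiliary vertices. -/
def tailColouring {T : Type v} (n : ℕ) (ω : DirColouring K (T ⊕ ℕ)) :
    DirColouring (tailPalette K n) T :=
  fun _ ψ => comap (withTail ψ) ω

theorem withTail_trans {Q R T : Type*} (f : Q ↪ R) (g : R ↪ T) :
    (withTail f).trans (withTail g) = withTail (f.trans g) := by
  ext (x | x) <;> rfl

theorem comap_tailColouring {R : Type w} {T : Type v} (n : ℕ) (e : R ↪ T)
    (ω : DirColouring K (T ⊕ ℕ)) :
    comap e (tailColouring n ω) = tailColouring n (comap (withTail e) ω) := by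
  funext j ψ
  change comap _ ω = comap ((withTail ψ).trans (withTail e)) ω
  rw [withTail_trans]

variable [∀ i, MeasurableSpace (K i)]

theorem measurable_tailColouring {T : Type v} (n : ℕ) :
    Measurable (tailColouring n : DirColouring K (T ⊕ ℕ) → _) :=
  measurable_pi_iff.2 fun _ => measurable_pi_iff.2 fun _ => measurable_comap _

/-- The conditional law of a colouring given its lower-rank tail colouring has a version that is
covariant everywhere. -/
theorem exists_covariant_kernel [∀ i, StandardBorelSpace (K i)] {n : ℕ}
    (ρ : Measure (DirColouring K (Fin n ⊕ ℕ))) [IsProbabilityMeasure ρ]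
    (hρ : ∀ g : Equiv.Perm (Fin n), ρ.map (comap (withTail g.toEmbedding)) = ρ) :
    ∃ Q : Kernel (DirColouring (tailPalette K n) (Fin n)) (DirColouring K (Fin n ⊕ ℕ)),
      IsMarkovKernel Q ∧
      (∀ (g : Equiv.Perm (Fin n)) x,
        Q (comap g.toEmbedding x) = (Q x).map (comap (withTail g.toEmbedding))) ∧
      ∀ A t, MeasurableSet A → MeasurableSet t →
        ∫⁻ z in tailColouring n ⁻¹' A, Q (tailColouring n z) t ∂ρ =
          ρ (t ∩ tailColouring n ⁻¹' A) := by
  have hne : Nonempty (DirColouring K (Fin n ⊕ ℕ)) := nonempty_of_isProbabilityMeasure ρ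
  have hΞ := measurable_tailColouring (K := K) (T := Fin n) n
  let Q₀ := condDistrib (id : DirColouring K (Fin n ⊕ ℕ) → _) (tailColouring n) ρ
  let act : Equiv.Perm (Fin n) → DirColouring K (Fin n ⊕ ℕ) → DirColouring K (Fin n ⊕ ℕ) :=
    fun g => comap (withTail g.toEmbedding)
  have hact : ∀ g, Measurable (act g) := fun g => measurable_comap _
  have hactmul : ∀ g h z, act g (act h z) = act (h * g) z := by
    intro g h z
    change comap ((withTail _).trans (withTail _)) z = _
    rw [withTail_trans]
    rfl
  have hactone : ∀ z, act 1 z = z := by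
    intro z
    change comap _ z = _
    have : withTail (1 : Equiv.Perm (Fin n)).toEmbedding = Function.Embedding.refl _ := by
      ext (x | x) <;> rfl
    rw [this]
    rfl
  let N : ENNReal := (Fintype.card (Equiv.Perm (Fin n)) : ENNReal)
  have hN0 : N ≠ 0 := by simp [N, Fintype.card_ne_zero]
  have hNt : N ≠ ⊤ := ENNReal.natCast_ne_top _
  -- Average over the group of the transported versions. Reindexing the sum by left multiplication
  -- with `g` gives covariance at every point. By invariance of `ρ` each summand is again a version
  -- of the conditional law, hence so is the average.
  let q : DirColouring (tailPalette K n) (Fin n) → Measure (DirColouring K (Fin n ⊕ ℕ)) :=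
    fun x => N⁻¹ • ∑ g : Equiv.Perm (Fin n), (Q₀ (comap g.toEmbedding x)).map (act g⁻¹)
  have hq : ∀ x t, MeasurableSet t → q x t =
      N⁻¹ * ∑ g : Equiv.Perm (Fin n), Q₀ (comap g.toEmbedding x) (act g⁻¹ ⁻¹' t) := by
    intro x t ht
    simp only [q, Measure.smul_apply, Measure.finsetSum_apply, smul_eq_mul]
    congr 1
    exact Finset.sum_congr rfl fun g _ => Measure.map_apply (hact _) ht
  have hmeas : ∀ (g : Equiv.Perm (Fin n)) t, MeasurableSet t →
      Measurable fun x => Q₀ (comap g.toEmbedding x) (act g⁻¹ ⁻¹' t) := fun g t ht =>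
    (Q₀.measurable_coe (hact _ ht)).comp (measurable_comap _)
  have hqm : Measurable q := by
    refine Measure.measurable_of_measurable_coe _ fun t ht => ?_
    simp only [hq _ t ht]
    exact (Finset.measurable_sum _ fun g _ => hmeas g t ht).const_mul _
  refine ⟨⟨q, hqm⟩, ⟨fun x => ⟨?_⟩⟩, fun g x => ?_, fun A t hA ht => ?_⟩
  · change q x Set.univ = 1
    rw [hq x _ MeasurableSet.univ]
    simp only [Set.preimage_univ, measure_univ, Finset.sum_const, Finset.card_univ, nsmul_eq_mul,
      mul_one]
    exact ENNReal.inv_mul_cancel hN0 hNt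
  · change q (comap g.toEmbedding x) = (q x).map (act g)
    ext t ht
    rw [Measure.map_apply (hact g) ht, hq _ _ ht, hq _ _ (hact g ht)]
    congr 1
    refine Fintype.sum_equiv (Equiv.mulLeft g) _ _ fun h => ?_
    have h1 : comap h.toEmbedding (comap g.toEmbedding x) =
        comap ((Equiv.mulLeft g) h).toEmbedding x := rfl
    rw [h1]
    congr 1
    ext z
    simp [hactmul]
  · change ∫⁻ z in tailColouring n ⁻¹' A, q (tailColouring n z) t ∂ρ = _
    simp only [hq _ t ht]
    have hmeasΞ : ∀ g : Equiv.Perm (Fin n), Measurable fun z : DirColouring K (Fin n ⊕ ℕ) =>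
        Q₀ (comap g.toEmbedding (tailColouring n z)) (act g⁻¹ ⁻¹' t) := fun g =>
      (hmeas g t ht).comp hΞ
    rw [lintegral_const_mul _ (Finset.measurable_fun_sum _ fun g _ => hmeasΞ g),
      lintegral_finsetSum _ fun g _ => hmeasΞ g]
    have key : ∀ g : Equiv.Perm (Fin n),
        ∫⁻ z in tailColouring n ⁻¹' A,
          Q₀ (comap g.toEmbedding (tailColouring n z)) (act g⁻¹ ⁻¹' t) ∂ρ =
        ρ (t ∩ tailColouring n ⁻¹' A) := by
      intro g
      have hginv : ∀ z, act g⁻¹ (act g z) = z := fun z => by simp [hactmul, hactone]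
      let A' := (comap (g⁻¹ : Equiv.Perm (Fin n)).toEmbedding :
        DirColouring (tailPalette K n) (Fin n) → _) ⁻¹' A
      have hA' : MeasurableSet A' := measurable_comap _ hA
      have hAA : ∀ z, tailColouring n (act g z) ∈ A' ↔ tailColouring n z ∈ A := by
        intro z
        change comap _ _ ∈ A ↔ _
        rw [comap_tailColouring]
        change tailColouring n (act g⁻¹ (act g z)) ∈ A ↔ _
        rw [hginv]
      have h1 := setLIntegral_preimage_condDistrib (μ := ρ) hΞ
        (measurable_id (α := DirColouring K (Fin n ⊕ ℕ))).aemeasurable (hact g⁻¹ ht) hA'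
      have hgm : MeasurePreserving (act g) ρ ρ := ⟨hact g, hρ g⟩
      rw [Set.preimage_id, ← hgm.setLIntegral_comp_preimage (hΞ hA')
          (f := fun z => Q₀ (tailColouring n z) (act g⁻¹ ⁻¹' t))
          ((Q₀.measurable_coe (hact _ ht)).comp hΞ),
        ← hgm.measure_preimage ((hΞ hA').inter (hact g⁻¹ ht)).nullMeasurableSet] at h1
      have h2 : act g ⁻¹' (tailColouring n ⁻¹' A') = tailColouring n ⁻¹' A := by
        ext z; exact hAA z
      have h3 : act g ⁻¹' (tailColouring n ⁻¹' A' ∩ act g⁻¹ ⁻¹' t) =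
          t ∩ tailColouring n ⁻¹' A := by
        rw [Set.preimage_inter, h2, Set.inter_comm]
        congr 1
        ext z
        simp [hginv]
      rw [h3, h2] at h1
      rw [← h1]
      refine lintegral_congr fun z => ?_
      rw [comap_tailColouring]
    rw [Finset.sum_congr rfl fun g _ => key g]
    simp only [Finset.sum_const, Finset.card_univ, nsmul_eq_mul]
    rw [← mul_assoc, ENNReal.inv_mul_cancel hN0 hNt, one_mul]

/-! ### Conditional independence by pushing vertices into the tail -/

section Avoiding

variable {S : Type v}

/-- The events that depend on the tail colours of tuples that do not pass through all of `e`. -/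
@[reducible] def avoidingSigma (K : Fin m → Type u) [∀ i, MeasurableSpace (K i)] {n : ℕ} (e : Fin n ↪ S) :
    MeasurableSpace (DirColouring K (S ⊕ ℕ)) :=
  ⨆ (j : ℕ) (ψ : Fin j ↪ S) (_ : ¬ Set.range e ⊆ Set.range ψ),
    MeasurableSpace.comap (comap (withTail ψ)) MeasurableSpace.pi

theorem avoidingSigma_le {n : ℕ} (e : Fin n ↪ S) : avoidingSigma K e ≤ MeasurableSpace.pi :=
  iSup_le fun _ => iSup_le fun _ => iSup_le fun _ => (measurable_comap _).comap_le

theorem measurable_avoidingSigma {n : ℕ} (e : Fin n ↪ S) {j : ℕ} (ψ : Fin j ↪ S)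
    (h : ¬ Set.range e ⊆ Set.range ψ) :
    Measurable[avoidingSigma K e] (comap (withTail ψ) : DirColouring K (S ⊕ ℕ) → _) :=
  measurable_iff_comap_le.2 (le_iSup_of_le j (le_iSup_of_le ψ (le_iSup_of_le h le_rfl)))

theorem not_range_subset_of_lt {n j : ℕ} (hj : j < n) (e : Fin n ↪ S) (ψ : Fin j ↪ S) :
    ¬ Set.range e ⊆ Set.range ψ := by
  intro h
  have := Set.ncard_le_ncard h (Set.finite_range ψ)
  rw [Set.ncard_range_of_injective e.injective, Set.ncard_range_of_injective ψ.injective] at this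
  simp at this
  omega

theorem measurable_tailColouring_avoidingSigma {n : ℕ} (e : Fin n ↪ S) :
    Measurable[avoidingSigma K e] (tailColouring n : DirColouring K (S ⊕ ℕ) → _) :=
  @measurable_pi_lambda _ _ _ (avoidingSigma K e) _ _ fun j =>
    @measurable_pi_lambda _ _ _ (avoidingSigma K e) _ _ fun ψ =>
    measurable_avoidingSigma e ψ (not_range_subset_of_lt j.2 e ψ)

open Classical in
/-- Fix the vertices in `R` and the first `N` auxiliary vertices, and move all other vertices to
auxiliary ones. -/
noncomputable def pushToTail (R : Set S) (ι : S ↪ ℕ) (N : ℕ) : S ⊕ ℕ ↪ S ⊕ ℕ where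
  -- Beyond `N`, even offsets receive the displaced vertices of `S` and odd offsets the displaced
  -- auxiliary ones, which keeps the map injective.
  toFun := Sum.elim (fun s => if s ∈ R then Sum.inl s else Sum.inr (N + 2 * ι s))
    (fun a => if a < N then Sum.inr a else Sum.inr (N + 2 * a + 1))
  inj' := by
    rintro (s | a) (s' | a') h <;> simp only [Sum.elim_inl, Sum.elim_inr] at h <;> split_ifs at h <;>
      simp only [Sum.inl.injEq, Sum.inr.injEq, reduceCtorEq] at h ⊢ <;>
      first
      | exact h
      | exact ι.injective (by omega)
      | omega

theorem exists_embedding_trans_eq {Q R T : Type*} (f : Q ↪ T) (g : R ↪ T)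
    (h : ∀ a, ∃ b, g b = f a) : ∃ f' : Q ↪ R, f'.trans g = f := by
  choose r hr using h
  refine ⟨⟨r, fun a b hab => f.injective ?_⟩, ?_⟩
  · rw [← hr, ← hr, hab]
  · ext a
    exact hr a

/-- A tuple `ψ` missing a vertex of `e` meets `e` in a proper part. After the push all its other
vertices are auxiliary, so its tail colour can be read off from that of the subtuple of `e`
enumerating this part. -/
theorem comap_avoidingSigma_le {n : ℕ} (e : Fin n ↪ S) (ι : S ↪ ℕ) (N : ℕ) :
    (avoidingSigma K e).comap (comap (pushToTail (Set.range e) ι N)) ≤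
      MeasurableSpace.comap (fun ω : DirColouring K (S ⊕ ℕ) =>
        tailColouring n (comap (withTail e) ω)) MeasurableSpace.pi := by
  classical
  simp only [avoidingSigma, MeasurableSpace.comap_iSup, MeasurableSpace.comap_comp]
  refine iSup_le fun j => iSup_le fun ψ => iSup_le fun hψ => ?_
  let I : Finset (Fin n) := Finset.univ.filter fun b => e b ∈ Set.range ψ
  have hI : I.card < n := by
    have : I ⊂ Finset.univ := by
      refine Finset.filter_ssubset.2 ?_
      by_contra hcon
      push Not at hcon
      refine hψ ?_
      rintro _ ⟨b, rfl⟩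
      exact hcon b (Finset.mem_univ b)
    simpa using Finset.card_lt_card this
  let r : Fin I.card ↪ Fin n := (I.orderEmbOfFin rfl).toEmbedding
  obtain ⟨f', hf'⟩ := exists_embedding_trans_eq
    ((withTail ψ).trans (pushToTail (Set.range e) ι N)) (withTail (r.trans e)) (by
      rintro (a | a)
      · by_cases ha : ψ a ∈ Set.range e
        · obtain ⟨b, hb⟩ := ha
          have hbI : b ∈ I := by simp [I, hb]
          have : b ∈ Set.range (I.orderEmbOfFin rfl) := by simpa using hbI
          obtain ⟨c, hc⟩ := this
          refine ⟨Sum.inl c, ?_⟩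
          have : r c = b := hc
          simp [pushToTail, this, ← hb]
        · refine ⟨Sum.inr (N + 2 * ι (ψ a)), ?_⟩
          have ha' : ¬ ∃ y, e y = ψ a := ha
          simp [pushToTail, ha']
      · by_cases ha : a < N
        · exact ⟨Sum.inr a, by simp [pushToTail, ha]⟩
        · exact ⟨Sum.inr (N + 2 * a + 1), by simp [pushToTail, ha]⟩)
  have h : (comap (withTail ψ) : DirColouring K (S ⊕ ℕ) → _) ∘
      comap (pushToTail (Set.range e) ι N) =
      (fun x : DirColouring (tailPalette K n) (Fin n) => comap f' (x ⟨I.card, hI⟩ r)) ∘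
        fun ω => tailColouring n (comap (withTail e) ω) := by
    funext ω
    change comap ((withTail ψ).trans (pushToTail (Set.range e) ι N)) ω =
      comap (f'.trans ((withTail r).trans (withTail e))) ω
    rw [withTail_trans, hf']
  rw [h, ← MeasurableSpace.comap_comp]
  refine MeasurableSpace.comap_mono (Measurable.comap_le ?_)
  exact (measurable_comap f').comp ((measurable_pi_apply r).comp (measurable_pi_apply _))

/-- Given the tail colours of the proper subtuples of `e`, the tail colour of `e` is independent of
the tail colours of all tuples that do not pass through all of `e`. -/
theorem setLIntegral_eq_of_avoidingSigma [Countable S] {ν : Measure (DirColouring K (S ⊕ ℕ))}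
    [IsProbabilityMeasure ν] (hν : IsExchangeable ν) {n : ℕ} (e : Fin n ↪ S)
    (Q : Kernel (DirColouring (tailPalette K n) (Fin n)) (DirColouring K (Fin n ⊕ ℕ)))
    [IsMarkovKernel Q]
    (hQ : ∀ A t, MeasurableSet A → MeasurableSet t →
      ∫⁻ ω in {ω | tailColouring n (comap (withTail e) ω) ∈ A},
        Q (tailColouring n (comap (withTail e) ω)) t ∂ν =
      ν (comap (withTail e) ⁻¹' t ∩ {ω | tailColouring n (comap (withTail e) ω) ∈ A}))
    {B : Set (DirColouring K (S ⊕ ℕ))} (hB : MeasurableSet[avoidingSigma K e] B)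
    {t : Set (DirColouring K (Fin n ⊕ ℕ))} (ht : MeasurableSet t) :
    ∫⁻ ω in B, Q (tailColouring n (comap (withTail e) ω)) t ∂ν =
      ν (comap (withTail e) ⁻¹' t ∩ B) := by
  classical
  have hx : Measurable fun ω : DirColouring K (S ⊕ ℕ) => tailColouring n (comap (withTail e) ω) :=
    (measurable_tailColouring n).comp (measurable_comap _)
  have hz : Measurable (comap (withTail e) : DirColouring K (S ⊕ ℕ) → _) := measurable_comap _
  let m₁ := (ν.restrict B).map (comap (withTail e))
  let m₂ := ((ν.restrict B).map fun ω => tailColouring n (comap (withTail e) ω)).bind Q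
  have hm₁ : ∀ t, MeasurableSet t → m₁ t = ν (comap (withTail e) ⁻¹' t ∩ B) := fun t ht => by
    rw [Measure.map_apply hz ht, Measure.restrict_apply (hz ht)]
  have hm₂ : ∀ t, MeasurableSet t →
      m₂ t = ∫⁻ ω in B, Q (tailColouring n (comap (withTail e) ω)) t ∂ν := fun t ht => by
    rw [Measure.bind_apply ht Q.aemeasurable, lintegral_map (Q.measurable_coe ht) hx]
  suffices h : m₁ = m₂ by rw [← hm₁ t ht, ← hm₂ t ht, h]
  -- Both sides are measures in `t`, so events seen on a finite vertex set `s` suffice. Only for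
  -- these can `N` be chosen so that the push fixes every vertex involved.
  refine measure_ext fun s => Measure.ext fun t' ht' => ?_
  set t : Set (DirColouring K (Fin n ⊕ ℕ)) :=
    comap (Function.Embedding.subtype (· ∈ s)) ⁻¹' t' with htdef
  have ht : MeasurableSet t := measurable_comap _ ht'
  rw [Measure.map_apply (measurable_comap _) ht', Measure.map_apply (measurable_comap _) ht',
    hm₁ _ ht, hm₂ _ ht]
  obtain ⟨ι, hι⟩ := Countable.exists_injective_nat S
  obtain ⟨N, hN⟩ : ∃ N, ∀ a, (Sum.inr a : Fin n ⊕ ℕ) ∈ s → a < N := by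
    let s' : Finset ℕ := s.preimage Sum.inr Sum.inr_injective.injOn
    refine ⟨s'.sup id + 1, fun a ha => Nat.lt_succ_of_le ?_⟩
    exact Finset.le_sup (f := id) (by simpa [s'] using ha)
  let h := pushToTail (Set.range e) ⟨ι, hι⟩ N
  -- The map `h` need not be onto; it preserves `ν` because marginals along any two embeddings
  -- agree, here `h` and the identity.
  have hτ : MeasurePreserving (comap h) ν ν :=
    ⟨measurable_comap _, (hν.map_comap_eq h (Function.Embedding.refl _)).trans Measure.map_id⟩
  have hFG : MeasurableSpace.comap (fun ω : DirColouring K (S ⊕ ℕ) =>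
      tailColouring n (comap (withTail e) ω)) MeasurableSpace.pi ≤ avoidingSigma K e := by
    have h1 : (fun ω : DirColouring K (S ⊕ ℕ) => tailColouring n (comap (withTail e) ω)) =
        comap e ∘ tailColouring n := by
      funext ω
      exact (comap_tailColouring n e ω).symm
    rw [h1, ← measurable_iff_comap_le]
    exact (measurable_comap e).comp (measurable_tailColouring_avoidingSigma e)
  have hinv : comap h ⁻¹' (comap (withTail e) ⁻¹' t) =
      (comap (withTail e) ⁻¹' t : Set (DirColouring K (S ⊕ ℕ))) := by
    have h1 : ((Function.Embedding.subtype (· ∈ s)).trans (withTail e)).trans h =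
        (Function.Embedding.subtype (· ∈ s)).trans (withTail e) := by
      ext ⟨a | a, ha⟩
      · simp [h, pushToTail]
      · simp [h, pushToTail, hN a ha]
    ext ω
    change comap (((Function.Embedding.subtype (· ∈ s)).trans (withTail e)).trans h) ω ∈ t' ↔
      comap ((Function.Embedding.subtype (· ∈ s)).trans (withTail e)) ω ∈ t'
    rw [h1]
  refine (hτ.setLIntegral_eq_of_comap_le (comap_avoidingSigma_le e ⟨ι, hι⟩ N) hFG
    (avoidingSigma_le e) (hz ht) hinv ?_ ?_ hB).symm
  · exact (Q.measurable_coe ht).comp (comap_measurable _)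
  · rintro _ ⟨A, hA, rfl⟩
    exact hQ A t hA ht

end Avoiding

end DirColouring

/-! ### One step of the recipe: independence of the clusters of one rank -/

/-- The hypothesis says that `ν` restricted to `E` and `ν` with density `c` agree on `G`, so they
integrate `G`-measurable functions alike. -/
theorem MeasureTheory.lintegral_mul_indicator_eq_of_setLIntegral_eq {Ω : Type*}
    {G mΩ : MeasurableSpace Ω} {ν : Measure Ω} [IsFiniteMeasure ν] (hG : G ≤ mΩ)
    {c : Ω → ENNReal} (hc : Measurable c) {E : Set Ω} (hE : MeasurableSet E)
    (h : ∀ B, MeasurableSet[G] B → ∫⁻ ω in B, c ω ∂ν = ν (E ∩ B)) {b : Ω → ENNReal}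
    (hb : Measurable[G] b) :
    ∫⁻ ω, b ω * E.indicator 1 ω ∂ν = ∫⁻ ω, b ω * c ω ∂ν := by
  have h1 : (ν.restrict E).trim hG = (ν.withDensity c).trim hG := by
    refine @Measure.ext _ G _ _ fun B hB => ?_
    rw [trim_measurableSet_eq hG hB, trim_measurableSet_eq hG hB, withDensity_apply _ (hG _ hB),
      h B hB, Measure.restrict_apply (hG _ hB), Set.inter_comm]
  have h2 : ∫⁻ ω, b ω ∂(ν.restrict E) = ∫⁻ ω, b ω ∂(ν.withDensity c) := by
    rw [← lintegral_trim hG hb, ← lintegral_trim hG hb, h1]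
  rw [lintegral_withDensity_eq_lintegral_mul _ hc (hb.mono hG le_rfl), ← lintegral_indicator hE]
    at h2
  refine Eq.trans (lintegral_congr fun ω => ?_) (h2.trans (lintegral_congr fun ω => mul_comm _ _))
  by_cases hω : ω ∈ E <;> simp [hω]

namespace DirColouring

variable {m : ℕ} {K : Fin m → Type u} {S : Type v} {n : ℕ} {L : Type u}

/-- Split colours of all `n`-tuples into one cluster above each `n`-set. -/
def disassemble (y : (Fin n ↪ S) → L) (u : {u : Finset S // u.card = n}) : (Fin n ↪ u.1) → L :=
  fun φ => y (φ.trans (Function.Embedding.subtype _))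

theorem disassemble_assemble (z : ∀ u : {u : Finset S // u.card = n}, (Fin n ↪ u.1) → L) :
    disassemble (assemble z) = z := by
  -- The set recovered from the range of `φ` equals `u` only propositionally, so the comparison is
  -- made for a variable `v`.
  have key : ∀ (u v : {u : Finset S // u.card = n}) (φ : Fin n ↪ u.1) (ψ : Fin n ↪ v.1),
      v = u → (∀ a, (ψ a : S) = φ a) → z v ψ = z u φ := by
    rintro u v φ ψ rfl h
    congr 1
    ext a
    exact h a
  funext u φ
  refine key _ _ _ _ (Subtype.ext (Finset.eq_of_subset_of_card_le ?_ ?_)) fun a => rfl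
  · intro s hs
    obtain ⟨a, -, rfl⟩ := Finset.mem_map.1 hs
    exact (φ a).2
  · simp [u.2]

variable [∀ i, MeasurableSpace (K i)] [MeasurableSpace L]

theorem measurable_disassemble : Measurable (disassemble (S := S) (n := n) (L := L)) := by
  unfold disassemble
  fun_prop

/-- The colours of rank `n` read off from the tail colours. -/
def tailRead (q : DirColouring K (Fin n ⊕ ℕ) → L) (ω : DirColouring K (S ⊕ ℕ)) :
    (Fin n ↪ S) → L :=
  fun φ => q (comap (withTail φ) ω)

theorem measurable_tailRead {q : DirColouring K (Fin n ⊕ ℕ) → L} (hq : Measurable q) :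
    Measurable (tailRead (S := S) q) :=
  measurable_pi_iff.2 fun _ => hq.comp (measurable_comap _)

/-- The enumeration of the `n`-set `u` as an injective tuple. -/
noncomputable abbrev enum (u : {u : Finset S // u.card = n}) : Fin n ↪ S :=
  (u.1.equivFinOfCardEq u.2).symm.toEmbedding.trans (Function.Embedding.subtype _)

theorem range_enum (u : {u : Finset S // u.card = n}) : Set.range (enum u) = u.1 := by
  ext s
  constructor
  · rintro ⟨a, rfl⟩
    exact ((u.1.equivFinOfCardEq u.2).symm a).2
  · intro hs
    exact ⟨u.1.equivFinOfCardEq u.2 ⟨s, hs⟩, by simp⟩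

theorem measurable_disassemble_tailRead_avoidingSigma {q : DirColouring K (Fin n ⊕ ℕ) → L}
    (hq : Measurable q) {u v : {u : Finset S // u.card = n}} (huv : u ≠ v) :
    Measurable[avoidingSigma K (enum u)]
      fun ω : DirColouring K (S ⊕ ℕ) => disassemble (tailRead q ω) v := by
  refine @measurable_pi_lambda _ _ _ (avoidingSigma K (enum u)) _ _ fun φ => ?_
  refine hq.comp (measurable_avoidingSigma _ _ fun h => huv ?_)
  rw [range_enum] at h
  refine Subtype.ext (Finset.eq_of_subset_of_card_le (fun s hs => ?_) (by rw [u.2, v.2]))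
  obtain ⟨a, rfl⟩ := h hs
  exact (φ a).2

/-- There is a covariant kernel that gives the conditional law of each cluster of rank `n` given
all tail colours of tuples that do not pass through all of its vertices. -/
theorem exists_cluster_kernel [∀ i, StandardBorelSpace (K i)] [Countable S] [Infinite S]
    {ν : Measure (DirColouring K (S ⊕ ℕ))} [IsProbabilityMeasure ν] (hν : IsExchangeable ν)
    {q : DirColouring K (Fin n ⊕ ℕ) → L} (hq : Measurable q) :
    ∃ P : Kernel (DirColouring (tailPalette K n) (Fin n)) (Equiv.Perm (Fin n) → L),
      IsMarkovKernel P ∧ IsCovariant P ∧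
      ∀ (u : {u : Finset S // u.card = n}) (t : Set ((Fin n ↪ u.1) → L)), MeasurableSet t →
        ∀ B, MeasurableSet[avoidingSigma K (enum u)] B →
          ∫⁻ ω in B, clusterLaw P (tailColouring n ω) (u.1.equivFinOfCardEq u.2).symm t ∂ν =
            ν ((fun ω => disassemble (tailRead q ω) u) ⁻¹' t ∩ B) := by
  let e₀ : Fin n ↪ S := Fin.valEmbedding.trans (Infinite.natEmbedding S)
  let ρ := ν.map (comap (withTail e₀))
  have hρp : IsProbabilityMeasure ρ :=
    Measure.isProbabilityMeasure_map (measurable_comap _).aemeasurable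
  obtain ⟨Q, hQm, hQc, hQ⟩ := exists_covariant_kernel ρ fun g => by
    rw [map_comap_map_comap]
    exact hν.map_comap_eq _ _
  let Θ : DirColouring K (Fin n ⊕ ℕ) → Equiv.Perm (Fin n) → L :=
    fun z σ => q (comap (withTail σ.toEmbedding) z)
  have hΘ : Measurable Θ := measurable_pi_iff.2 fun σ => hq.comp (measurable_comap _)
  refine ⟨Q.map Θ, Kernel.IsMarkovKernel.map _ hΘ, fun g x => ?_, fun u t ht B hB => ?_⟩
  · rw [Kernel.map_apply _ hΘ, Kernel.map_apply _ hΘ, hQc, Measure.map_map hΘ (measurable_comap _),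
      Measure.map_map (by fun_prop) hΘ]
    congr 1
    funext z σ
    change q (comap ((withTail σ.toEmbedding).trans (withTail g.toEmbedding)) z) = _
    rw [withTail_trans]
    rfl
  · have hQ' := setLIntegral_eq_of_avoidingSigma hν (enum u) Q (fun A t hA ht => by
      have h := hQ A t hA ht
      have hρe : ρ = ν.map (comap (withTail (enum u))) := hν.map_comap_eq _ _
      have hA' := measurable_tailColouring (K := K) (T := Fin n) n hA
      rw [hρe, Measure.map_apply (measurable_comap _) (ht.inter hA'),
        setLIntegral_map (f := fun z => Q (tailColouring n z) t) hA' ((Q.measurable_coe ht).comp (measurable_tailColouring n))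
          (measurable_comap _)] at h
      exact h) hB (t := Θ ⁻¹' ((fun y φ => y (permOfEnum (u.1.equivFinOfCardEq u.2).symm φ)) ⁻¹' t))
      (hΘ (measurable_relabel _ ht))
    refine Eq.trans (lintegral_congr fun ω => ?_) (hQ'.trans ?_)
    · rw [clusterLaw, Measure.map_apply (measurable_relabel _) ht, comap_tailColouring,
        Kernel.map_apply' _ hΘ _ (measurable_relabel _ ht)]
    · congr 2
      ext ω
      simp only [Set.mem_preimage]
      have : (fun φ => Θ (comap (withTail (enum u)) ω)
          (permOfEnum (u.1.equivFinOfCardEq u.2).symm φ)) = disassemble (tailRead q ω) u := by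
        funext φ
        change q (comap ((withTail _).trans (withTail (enum u))) ω) = q (comap (withTail _) ω)
        rw [withTail_trans]
        congr 3
        ext a
        simp [permOfEnum]
      rw [this]

/-- The indicators are replaced one at a time. For a set `u`, the lower-rank colours and the
clusters above the other `n`-sets, none of which contains `u`, are measurable for `avoidingSigma K
(enum u)`. The resulting cluster probability depends on lower ranks only and is absorbed into `g`,
which is why `g` is arbitrary. -/
theorem lintegral_mul_prod_indicator {ν : Measure (DirColouring K (S ⊕ ℕ))}
    [IsProbabilityMeasure ν] {q : DirColouring K (Fin n ⊕ ℕ) → L} (hq : Measurable q)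
    {P : Kernel (DirColouring (tailPalette K n) (Fin n)) (Equiv.Perm (Fin n) → L)}
    [IsMarkovKernel P]
    (hP : ∀ (u : {u : Finset S // u.card = n}) (t : Set ((Fin n ↪ u.1) → L)), MeasurableSet t →
      ∀ B, MeasurableSet[avoidingSigma K (enum u)] B →
        ∫⁻ ω in B, clusterLaw P (tailColouring n ω) (u.1.equivFinOfCardEq u.2).symm t ∂ν =
          ν ((fun ω => disassemble (tailRead q ω) u) ⁻¹' t ∩ B))
    {t : ∀ u : {u : Finset S // u.card = n}, Set ((Fin n ↪ u.1) → L)}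
    (ht : ∀ u, MeasurableSet (t u)) (s : Finset {u : Finset S // u.card = n})
    (g : DirColouring (tailPalette K n) S → ENNReal) (hg : Measurable g) :
    ∫⁻ ω, g (tailColouring n ω) *
        ∏ u ∈ s, ((fun ω => disassemble (tailRead q ω) u) ⁻¹' t u).indicator 1 ω ∂ν =
      ∫⁻ ω, g (tailColouring n ω) *
        ∏ u ∈ s, clusterLaw P (tailColouring n ω) (u.1.equivFinOfCardEq u.2).symm (t u) ∂ν := by
  classical
  have hcl : ∀ u : {u : Finset S // u.card = n}, Measurable fun x : DirColouring (tailPalette K n) S =>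
      clusterLaw P x (u.1.equivFinOfCardEq u.2).symm (t u) := fun u =>
    (Measure.measurable_coe (ht u)).comp (measurable_clusterLaw P _)
  induction s using Finset.induction_on generalizing g with
  | empty => simp
  | insert u s hu ih =>
    simp only [Finset.prod_insert hu]
    have hb₁ : Measurable[avoidingSigma K (enum u)]
        fun ω : DirColouring K (S ⊕ ℕ) => g (tailColouring n ω) :=
      hg.comp (measurable_tailColouring_avoidingSigma (enum u))
    have hb₂ : ∀ v ∈ s, Measurable[avoidingSigma K (enum u)]
        (((fun ω : DirColouring K (S ⊕ ℕ) => disassemble (tailRead q ω) v) ⁻¹' t v).indicator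
          (1 : DirColouring K (S ⊕ ℕ) → ENNReal)) := fun v hv => by
      have huv : u ≠ v := fun h => hu (by rwa [h])
      refine Measurable.indicator ?_ (measurable_disassemble_tailRead_avoidingSigma hq huv (ht v))
      exact @measurable_const _ _ _ (avoidingSigma K (enum u)) 1
    have h1 := lintegral_mul_indicator_eq_of_setLIntegral_eq (avoidingSigma_le (enum u))
      ((hcl u).comp (measurable_tailColouring n))
      ((measurable_pi_iff.1 (measurable_disassemble.comp (measurable_tailRead hq)) u) (ht u))
      (hP u (t u) (ht u)) (hb₁.mul (Finset.measurable_fun_prod s hb₂))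
    have h2 := ih (fun x => g x * clusterLaw P x (u.1.equivFinOfCardEq u.2).symm (t u))
      (hg.mul (hcl u))
    refine Eq.trans (lintegral_congr fun ω => ?_) (h1.trans
      (Eq.trans (lintegral_congr fun ω => ?_) (h2.trans (lintegral_congr fun ω => ?_))))
    · rw [Pi.mul_apply, mul_assoc]
      congr 1
      exact mul_comm _ _
    · simp only [Function.comp, Pi.mul_apply]
      ring
    · rw [mul_assoc]

/-- One step of the recipe, run on the law of the lower-rank tail colours, gives the joint law of
these and the colours of rank `n`. -/
theorem map_tailColouring_compProd {ν : Measure (DirColouring K (S ⊕ ℕ))}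
    [IsProbabilityMeasure ν] {q : DirColouring K (Fin n ⊕ ℕ) → L} (hq : Measurable q)
    {P : Kernel (DirColouring (tailPalette K n) (Fin n)) (Equiv.Perm (Fin n) → L)}
    [IsMarkovKernel P]
    (hP : ∀ (u : {u : Finset S // u.card = n}) (t : Set ((Fin n ↪ u.1) → L)), MeasurableSet t →
      ∀ B, MeasurableSet[avoidingSigma K (enum u)] B →
        ∫⁻ ω in B, clusterLaw P (tailColouring n ω) (u.1.equivFinOfCardEq u.2).symm t ∂ν =
          ν ((fun ω => disassemble (tailRead q ω) u) ⁻¹' t ∩ B)) :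
    ν.map (tailColouring n) ⊗ₘ clusterKernel P S =
      ν.map fun ω => (tailColouring n ω, tailRead q ω) := by
  have hX := measurable_tailColouring (K := K) (T := S) n
  have hV := measurable_tailRead (S := S) hq
  have hXp : IsProbabilityMeasure (ν.map (tailColouring (K := K) (T := S) n)) :=
    Measure.isProbabilityMeasure_map hX.aemeasurable
  have hfin : IsProbabilityMeasure (ν.map fun ω => (tailColouring n ω, tailRead q ω)) :=
    Measure.isProbabilityMeasure_map (hX.prodMk hV).aemeasurable
  have key : ∀ A : Set (DirColouring (tailPalette K n) S), MeasurableSet A →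
      (((ν.map (tailColouring n)).restrict A).bind (clusterKernel P S)) =
        (ν.restrict (tailColouring n ⁻¹' A)).map (tailRead q) := by
    intro A hA
    set m₁ := ((ν.map (tailColouring n)).restrict A).bind (clusterKernel P S)
    set m₂ := (ν.restrict (tailColouring n ⁻¹' A)).map (tailRead q)
    -- Splitting into clusters loses nothing, so measures may be compared there, where squares form
    -- a generating π-system.
    have hm : ∀ m : Measure ((Fin n ↪ S) → L), m = (m.map disassemble).map assemble := by
      intro m
      rw [Measure.map_map measurable_assemble measurable_disassemble]
      exact Measure.map_id.symm
    suffices h : m₁.map disassemble = m₂.map disassemble by rw [hm m₁, hm m₂, h]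
    have hcyl : ∀ (s : Finset {u : Finset S // u.card = n})
        (t : ∀ u : {u : Finset S // u.card = n}, Set ((Fin n ↪ u.1) → L)),
        (∀ u, MeasurableSet (t u)) →
        m₁.map disassemble ((s : Set _).pi t) = m₂.map disassemble ((s : Set _).pi t) := by
      intro s t ht
      have hpi : MeasurableSet ((s : Set {u : Finset S // u.card = n}).pi t) :=
        MeasurableSet.pi s.countable_toSet fun u _ => ht u
      have h1 := lintegral_mul_prod_indicator hq hP ht s (A.indicator 1)
        (measurable_one.indicator hA)
      rw [Measure.map_apply measurable_disassemble hpi, Measure.map_apply measurable_disassemble hpi,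
        Measure.bind_apply (measurable_disassemble hpi) (Kernel.aemeasurable _),
        Measure.map_apply hV (measurable_disassemble hpi),
        Measure.restrict_apply (hV (measurable_disassemble hpi))]
      have h2 : ∀ x, clusterKernel P S x (disassemble ⁻¹' (s : Set _).pi t) =
          ∏ u ∈ s, clusterLaw P x (u.1.equivFinOfCardEq u.2).symm (t u) := by
        intro x
        change (Measure.infinitePi fun u : {u : Finset S // u.card = n} =>
          clusterLaw P x (u.1.equivFinOfCardEq u.2).symm).map assemble _ = _
        rw [Measure.map_apply measurable_assemble (measurable_disassemble hpi),
          ← Measure.infinitePi_pi _ (fun u _ => ht u)]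
        congr 1
        ext z
        simp [disassemble_assemble]
      simp only [h2]
      have h3 : Measurable fun x : DirColouring (tailPalette K n) S =>
          ∏ u ∈ s, clusterLaw P x (u.1.equivFinOfCardEq u.2).symm (t u) :=
        Finset.measurable_fun_prod _ fun u _ =>
          (Measure.measurable_coe (ht u)).comp (measurable_clusterLaw P _)
      rw [setLIntegral_map hA h3 hX, ← lintegral_indicator (hX hA)]
      refine Eq.trans (lintegral_congr fun ω => ?_) (h1.symm.trans ?_)
      · by_cases hω : tailColouring n ω ∈ A <;> simp [hω]
      · rw [← lintegral_indicator_one ((hV (measurable_disassemble hpi)).inter (hX hA))]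
        refine lintegral_congr fun ω => ?_
        set E := tailRead q ⁻¹' (disassemble ⁻¹' (s : Set _).pi t) ∩ tailColouring n ⁻¹' A
        by_cases hω : tailColouring n ω ∈ A
        · by_cases hω' : ∀ u ∈ s, disassemble (tailRead q ω) u ∈ t u
          · rw [Set.indicator_of_mem hω, Set.indicator_of_mem
              (s := E) ⟨fun u hu => hω' u hu, hω⟩, Finset.prod_eq_one]
            · simp
            · intro u hu
              exact Set.indicator_of_mem (a := ω) (hω' u hu) _
          · rw [Set.indicator_of_notMem (s := E) (fun h => hω' fun u hu => h.1 u hu)]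
            push Not at hω'
            obtain ⟨u, hu, hut⟩ := hω'
            rw [Finset.prod_eq_zero hu (Set.indicator_of_notMem (a := ω) hut _), mul_zero]
        · rw [Set.indicator_of_notMem hω, zero_mul,
            Set.indicator_of_notMem (s := E) (fun h => hω h.2)]
    have hf : IsFiniteMeasure m₁ := by
      refine ⟨?_⟩
      rw [Measure.bind_apply MeasurableSet.univ (Kernel.aemeasurable _)]
      simp only [measure_univ, lintegral_const, one_mul]
      exact measure_lt_top _ _
    refine ext_of_generate_finite _ (generateFrom_squareCylinders).symm
      (isPiSystem_squareCylinders (fun _ => MeasurableSpace.isPiSystem_measurableSet)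
        (fun _ => by simp)) ?_ ?_
    · rintro _ ⟨s, t, ht, rfl⟩
      simp only [Set.mem_pi, Set.mem_univ, true_imp_iff, Set.mem_ofPred_eq] at ht
      exact hcyl s t ht
    · simpa using hcyl ∅ (fun _ => Set.univ) fun _ => MeasurableSet.univ
  refine Measure.ext_prod fun {A C} hA hC => ?_
  rw [Measure.compProd_apply_prod hA hC, Measure.map_apply (hX.prodMk hV) (hA.prod hC)]
  have h := congrArg (fun m => m C) (key A hA)
  simp only [Measure.bind_apply hC (Kernel.aemeasurable _), Measure.map_apply hV hC,
    Measure.restrict_apply (hV hC)] at h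
  rw [h, Set.inter_comm]
  rfl

end DirColouring

/-! ### Assembling the ingredients -/

theorem theorem3p21 {k : ℕ} (K : Fin (k + 2) → Type u) [∀ i, MeasurableSpace (K i)]
    [∀ i, StandardBorelSpace (K i)] (S : Type v) [Countable S] [Infinite S]
    (μ : Measure (DirColouring K S)) [IsProbabilityMeasure μ] (hμ : IsExchangeable μ) :
    ∃ I : DirectedIngredients K, I.Yields μ := by
  obtain ⟨c⟩ : Nonempty (S ⊕ ℕ ≃ S) := nonempty_equiv_of_countable
  let ν : Measure (DirColouring K (S ⊕ ℕ)) := μ.map (DirColouring.comap c.toEmbedding)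
  have hνp : IsProbabilityMeasure ν :=
    Measure.isProbabilityMeasure_map (DirColouring.measurable_comap _).aemeasurable
  have hν : IsExchangeable ν := hμ.map_comap _
  have hνμ : ν.map (DirColouring.comap Function.Embedding.inl) = μ := by
    rw [DirColouring.map_comap_map_comap]
    exact (hμ.map_comap_eq _ (Function.Embedding.refl S)).trans Measure.map_id
  choose P hPm hPc hP using fun n : ℕ =>
    DirColouring.exists_cluster_kernel (n := n) hν
      (measurable_id (α := DirColouring K (Fin n ⊕ ℕ)))
  -- At the top rank only the colour of the tuple itself is kept, since the last kernel must take
  -- values in the original colour space.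
  let qtop : DirColouring K (Fin (k + 1) ⊕ ℕ) → K (Fin.last (k + 1)) := fun z =>
    z (Fin.last (k + 1)) Function.Embedding.inl
  have hqtop : Measurable qtop := (measurable_pi_apply _).comp (measurable_pi_apply _)
  obtain ⟨Ptop, hPtopm, hPtopc, hPtop⟩ := DirColouring.exists_cluster_kernel hν hqtop
  let I : DirectedIngredients K :=
    { Z := fun i => DirColouring K (Fin (i : ℕ) ⊕ ℕ)
      measurableSpace := fun i => inferInstance
      standardBorel := fun i => inferInstance
      κ := fun i z => z i.castSucc Function.Embedding.inl
      measurable_κ := fun i => (measurable_pi_apply _).comp (measurable_pi_apply _)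
      -- `Sym([0])` and the source of `P 0` have one point each, so evaluating at `1` loses nothing.
      μ₀ := (P 0 fun i => i.elim0).map fun y => y 1
      isProbabilityMeasure :=
        Measure.isProbabilityMeasure_map (measurable_pi_apply _).aemeasurable
      P := fun i => P (i.succ : ℕ)
      isMarkovKernel := fun i => hPm _
      covariant := fun i => hPc _
      Ptop := Ptop
      isMarkovKernel_top := hPtopm
      covariant_top := hPtopc }
  have hrank : ∀ (n : ℕ) (h : n < k + 1), I.rankKernel n h = P n := by
    intro n h
    cases n with
    | zero =>
      ext1 x
      have hx : x = fun i => i.elim0 := funext fun i => i.elim0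
      subst hx
      change ((P 0 fun i => i.elim0).map fun y => y 1).map (fun z _ => z) = P 0 fun i => i.elim0
      have hid : ((fun z _ => z) ∘ fun y => y 1 :
          (Equiv.Perm (Fin 0) → DirColouring K (Fin 0 ⊕ ℕ)) → _) = id := by
        funext y σ
        exact congrArg y (Subsingleton.elim _ _)
      refine (Measure.map_map (μ := P 0 fun i => i.elim0)
        (f := fun y : Equiv.Perm (Fin 0) → DirColouring K (Fin 0 ⊕ ℕ) => y 1)
        (g := fun (z : DirColouring K (Fin 0 ⊕ ℕ)) (_ : Equiv.Perm (Fin 0)) => z)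
        (measurable_pi_lambda _ fun _ => measurable_id) (measurable_pi_apply _)).trans ?_
      rw [hid, Measure.map_id]
    | succ n => rfl
  -- At ranks up to `k` the full tail colour is read (`q = id`), so adjoining rank `n` to
  -- `tailColouring n` gives exactly `tailColouring (n + 1)`.
  have hstage : ∀ (n : ℕ) (h : n ≤ k + 1),
      I.stageLaw S n h = ν.map (DirColouring.tailColouring n) := by
    intro n
    induction n with
    | zero =>
      intro h
      have hconst : (DirColouring.tailColouring 0 : DirColouring K (S ⊕ ℕ) → _) =
          fun _ i => i.elim0 := by
        funext ω i
        exact i.elim0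
      rw [hconst, Measure.map_const, measure_univ, one_smul]
      rfl
    | succ n ih =>
      intro h
      have hstep := DirColouring.map_tailColouring_compProd measurable_id (hP n)
      change (I.stageLaw S n (Nat.le_of_succ_le h) ⊗ₘ
        clusterKernel (I.rankKernel n h) S).map _ = _
      have hk : clusterKernel (I.rankKernel n h) S = clusterKernel (P n) S := by
        congr 1
        exact hrank n h
      rw [ih, hk]
      refine (congrArg _ hstep).trans ?_
      refine (Measure.map_map (DirColouring.measurable_extend (W := truncate I.Z (n + 1) h))
        ((DirColouring.measurable_tailColouring n).prodMk
          (DirColouring.measurable_tailRead measurable_id))).trans ?_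
      congr 1
      funext ω i
      induction i using Fin.lastCases with
      | last => simp [DirColouring.extend]; rfl
      | cast i => simp [DirColouring.extend]; rfl
  refine ⟨I, ?_⟩
  have hstep := DirColouring.map_tailColouring_compProd hqtop hPtop
  change (I.stageLaw S (k + 1) le_rfl ⊗ₘ clusterKernel I.Ptop S).map _ = μ
  rw [hstage]
  refine (congrArg _ hstep).trans ?_
  refine (Measure.map_map ?_ ((DirColouring.measurable_tailColouring _).prodMk
    (DirColouring.measurable_tailRead hqtop))).trans ?_
  · have h : Measurable fun p : DirColouring I.Z S × ((Fin (k + 1) ↪ S) → K (Fin.last (k + 1))) =>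
        ((fun i φ => I.κ i (p.1 i φ) : DirColouring (fun i => K i.castSucc) S), p.2) := by
      have := I.measurable_κ
      fun_prop
    exact DirColouring.measurable_extend.comp h
  -- Reading the tuple's own colour out of each tail colour restricts `ω` to the vertices in `S`,
  -- which recovers `μ`.
  · rw [← hνμ]
    congr 1
    funext ω i
    induction i using Fin.lastCases with
    | last => simp [DirColouring.extend]; rfl
    | cast i => simp [DirColouring.extend]; rfl
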